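/- For integers $g,n\ge 1$, write $\mathbb Z_g^n$ for the set of length-$n$ vectors $x=(x(1),\dots,x(n))$ with entries in $\mathbb Z_g$. A vector $x\in\mathbb Z_g^n$ is *balanced* if each symbol $a\in\mathbb Z_g$ occurs $\lfloor n/g\rfloor$ or $\lceil n/g\rceil$ times in $x$. Vectors $x\in\mathbb Z_{g}^n$, $x'\in\mathbb Z_{g'}^n$ are *pairwise balanced* if both are balanced and for each $(a,b)\in\mathbb Z_{g}\times\mathbb Z_{g'}$ the number of indices $i$ with $(x(i),x'(i))=(a,b)$ is $\lfloor n/(gg')\rfloor$ or $\lceil n/(gg')\rceil$. Vectors $x\in\mathbb Z_{g}^n$, $x'\in\mathbb Z_{g'}^n$, $x''\in\mathbb Z_{g''}^n$ are *3-qualitatively independent* if for every $(a,b,c)\in\mathbb Z_{g}\times\mathbb Z_{g'}\times\mathbb Z_{g''}$ there is an index $j\in\{1,\dots,n\}$ with $(x(j),x'(j),x''(j))=(a,b,c)$. Let $n,g_1,g_2,g_3$ be positive integers, and let $x_1\in\mathbb Z_{g_1}^n$, $x_2\in\mathbb Z_{g_2}^n$, $x_3\in\mathbb Z_{g_3}^n$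 be mutually pairwise balanced and 3-qualitatively independent. Let $h$ be a positive integer such that $$h\le\min\left\{\left\lfloor\frac{n}{g_1g_2}\right\rfloor,\left\lfloor\frac{n}{g_1g_3}\right\rfloor\right\}$$ and, if $h\ge 3$, $\left\lfloor\frac{n}{g_1g_2}\right\rfloor\equiv 0 \pmod h$. Then there exists a balanced vector $y\in\mathbb Z_h^n$ such that $x_1,x_2,y$ are 3-qualitatively independent and $y$ is pairwise balanced with each of $x_1,x_2,x_3$. -/

import Mathlib

/-- A length-`n` vector over `ℤ_g` is balanced if each symbol occurs `⌊n/g⌋` or `⌈n/g⌉` times. -/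
def IsBalanced {n g : ℕ} (x : Fin n → ZMod g) : Prop :=
  ∀ a : ZMod g,
    (Finset.univ.filter fun i => x i = a).card = n / g ∨
    (Finset.univ.filter fun i => x i = a).card = n ⌈/⌉ g

/-- Two length-`n` vectors are pairwise balanced if both are balanced and each pair of symbols
occurs `⌊n/(g₁g₂)⌋` or `⌈n/(g₁g₂)⌉` times. -/
def IsPairwiseBalanced {n g₁ g₂ : ℕ} (x₁ : Fin n → ZMod g₁) (x₂ : Fin n → ZMod g₂) : Prop :=
  IsBalanced x₁ ∧ IsBalanced x₂ ∧
  ∀ (a : ZMod g₁) (b : ZMod g₂),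
    (Finset.univ.filter fun i => x₁ i = a ∧ x₂ i = b).card = n / (g₁ * g₂) ∨
    (Finset.univ.filter fun i => x₁ i = a ∧ x₂ i = b).card = n ⌈/⌉ (g₁ * g₂)

/-- Three vectors are 3-qualitatively independent if every triple of symbols occurs at some
common index. -/
def IsQualitativelyIndependent₃ {n g₁ g₂ g₃ : ℕ}
    (x : Fin n → ZMod g₁) (y : Fin n → ZMod g₂) (z : Fin n → ZMod g₃) : Prop :=
  ∀ (a : ZMod g₁) (b : ZMod g₂) (c : ZMod g₃), ∃ j : Fin n, x j = a ∧ y j = b ∧ z j = c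

/-! View the indices as edges of a bipartite multigraph and y as an edge colouring with h colours.
By de Werra's theorem (`exists_equitable_coloring`) some colouring is equitable at every vertex and
overall, so the task is to choose the two vertex partitions.

The natural vertices are the cells of (x₁, x₂) on one side and the fibres of x₃ on the other. A
vertex whose size is a multiple of h is coloured uniformly, and a disjoint union of uniform parts
and one equitable part is equitable. By the congruence hypothesis every cell has size 0 or 1 mod h.
From each cell of size 1 mod h one leftover is removed; what remains is nonempty and uniform, hence
meets every colour. The leftovers of a column b form one vertex, which settles x₂.

For x₁, the leftovers of a row a must also be controlled. All but fewer than h of them form a vertex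
of size divisible by h; the others, indexed by R, are absorbed into an h-set T, on which each colour
occurs once. To keep x₃ equitable, each of these new vertices must lie in a single fibre of x₃.
Independence allows this: leftovers are picked with x₃ = c₁ on R and x₃ = c₀ off R, while (a, c₁)
has enough indices to complete T. -/

/-! ### Proper edge colourings of bipartite multigraphs -/

/-- A bipartite multigraph with edge set `S`, all of whose vertices have degree `h`, has a proper
edge colouring with `h` colours. -/
theorem exists_proper_coloring_of_regular {E A B : Type*} [DecidableEq E]
    [Fintype A] [DecidableEq A] [Fintype B] [DecidableEq B] (f : E → A) (g : E → B) (h : ℕ) :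
    ∀ S : Finset E, (∀ a, (S.filter fun e => f e = a).card = h) →
      (∀ b, (S.filter fun e => g e = b).card = h) →
      ∃ y : E → ℕ, (∀ e ∈ S, y e < h) ∧
        (∀ e ∈ S, ∀ e' ∈ S, f e = f e' → y e = y e' → e = e') ∧
        (∀ e ∈ S, ∀ e' ∈ S, g e = g e' → y e = y e' → e = e') := by
  induction h with
  | zero =>
    intro S hf _
    have hS : ∀ e, e ∉ S := fun e he => by
      have := Finset.card_eq_zero.1 (hf (f e))
      exact (Finset.notMem_empty e) (this ▸ Finset.mem_filter.2 ⟨he, rfl⟩)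
    exact ⟨fun _ => 0, fun e he => (hS e he).elim, fun e he => (hS e he).elim,
      fun e he => (hS e he).elim⟩
  | succ h ih =>
    intro S hf hg
    -- Hall's condition by double counting: the |s|(h + 1) edges leaving s are among the |N|(h + 1)
    -- edges entering its neighbourhood N.
    have hall : ∀ s : Finset A,
        s.card ≤ (s.biUnion fun a => (S.filter fun e => f e = a).image g).card := by
      intro s
      set N := s.biUnion fun a => (S.filter fun e => f e = a).image g with hN
      have h1 : (S.filter fun e => f e ∈ s).card = s.card * (h + 1) := by
        rw [Finset.card_eq_sum_card_fiberwise (s := S.filter fun e => f e ∈ s) (f := f) (t := s)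
          (fun e he => (Finset.mem_filter.1 he).2)]
        refine Finset.sum_const_nat fun a ha => ?_
        rw [← hf a, Finset.filter_filter]
        congr 1
        ext e
        simp only [Finset.mem_filter]
        exact ⟨fun h => ⟨h.1, h.2.2⟩, fun h => ⟨h.1, h.2 ▸ ha, h.2⟩⟩
      have h2 : (S.filter fun e => g e ∈ N).card = N.card * (h + 1) := by
        rw [Finset.card_eq_sum_card_fiberwise (s := S.filter fun e => g e ∈ N) (f := g) (t := N)
          (fun e he => (Finset.mem_filter.1 he).2)]
        refine Finset.sum_const_nat fun b hb => ?_
        rw [← hg b, Finset.filter_filter]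
        congr 1
        ext e
        simp only [Finset.mem_filter]
        exact ⟨fun h => ⟨h.1, h.2.2⟩, fun h => ⟨h.1, h.2 ▸ hb, h.2⟩⟩
      have h3 : (S.filter fun e => f e ∈ s) ⊆ S.filter fun e => g e ∈ N := by
        intro e he
        rw [Finset.mem_filter] at he ⊢
        exact ⟨he.1, Finset.mem_biUnion.2 ⟨f e, he.2,
          Finset.mem_image_of_mem g (Finset.mem_filter.2 ⟨he.1, rfl⟩)⟩⟩
      have h4 := Finset.card_le_card h3
      rw [h1, h2] at h4
      exact Nat.le_of_mul_le_mul_right h4 (Nat.succ_pos h)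
    obtain ⟨m, hm, hmem⟩ := (Finset.all_card_le_biUnion_card_iff_exists_injective _).1 hall
    have hAB : Fintype.card A = Fintype.card B := by
      have h1 := Finset.card_eq_sum_card_fiberwise (s := S) (f := f) (t := Finset.univ)
        (fun e _ => Finset.mem_univ _)
      have h2 := Finset.card_eq_sum_card_fiberwise (s := S) (f := g) (t := Finset.univ)
        (fun e _ => Finset.mem_univ _)
      simp only [hf, hg, Finset.sum_const, Finset.card_univ, smul_eq_mul] at h1 h2
      exact Nat.eq_of_mul_eq_mul_right (Nat.succ_pos h) (h1.symm.trans h2)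
    have hbij : Function.Bijective m := (Fintype.bijective_iff_injective_and_card m).2 ⟨hm, hAB⟩
    have hedge : ∀ a, ∃ e ∈ S, f e = a ∧ g e = m a := fun a => by
      obtain ⟨e, he, hge⟩ := Finset.mem_image.1 (hmem a)
      exact ⟨e, (Finset.mem_filter.1 he).1, (Finset.mem_filter.1 he).2, hge⟩
    choose ε hεS hεf hεg using hedge
    -- Deleting the perfect matching ε lowers every degree by one; the matching will receive the new
    -- colour h.
    have hεf' : ∀ a, (((S.filter fun e => e ≠ ε (f e))).filter fun e => f e = a).card = h := by
      intro a
      have : ((S.filter fun e => e ≠ ε (f e))).filter (fun e => f e = a) =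
          (S.filter fun e => f e = a).erase (ε a) := by
        ext e
        simp only [Finset.mem_filter, Finset.mem_erase]
        constructor
        · rintro ⟨⟨h1, h2⟩, h3⟩
          exact ⟨h3 ▸ h2, h1, h3⟩
        · rintro ⟨h1, h2, h3⟩
          exact ⟨⟨h2, h3 ▸ h1⟩, h3⟩
      rw [this, Finset.card_erase_of_mem (Finset.mem_filter.2 ⟨hεS a, hεf a⟩), hf]
      rfl
    have hεg' : ∀ b, (((S.filter fun e => e ≠ ε (f e))).filter fun e => g e = b).card = h := by
      intro b
      obtain ⟨a, rfl⟩ := hbij.2 b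
      have : ((S.filter fun e => e ≠ ε (f e))).filter (fun e => g e = m a) =
          (S.filter fun e => g e = m a).erase (ε a) := by
        ext e
        simp only [Finset.mem_filter, Finset.mem_erase]
        constructor
        · rintro ⟨⟨h1, h2⟩, h3⟩
          refine ⟨fun h4 => h2 ?_, h1, h3⟩
          rw [h4, hεf]
        · rintro ⟨h1, h2, h3⟩
          refine ⟨⟨h2, fun h4 => h1 ?_⟩, h3⟩
          have : m (f e) = m a := by rw [← hεg (f e), ← h4, h3]
          rw [h4, hm this]
      rw [this, Finset.card_erase_of_mem (Finset.mem_filter.2 ⟨hεS a, hεg a⟩), hg]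
      rfl
    obtain ⟨y, hy, hyf, hyg⟩ := ih _ hεf' hεg'
    have hlt : ∀ e ∈ S, e ≠ ε (f e) → y e < h := fun e he hne =>
      hy e (Finset.mem_filter.2 ⟨he, hne⟩)
    refine ⟨fun e => if e = ε (f e) then h else y e, ?_, ?_, ?_⟩
    · intro e he
      dsimp only
      split_ifs with h1
      · exact Nat.lt_succ_self h
      · exact (hlt e he h1).trans (Nat.lt_succ_self h)
    · intro e he e' he' hee hc
      dsimp only at hc
      split_ifs at hc with h1 h2 h2
      · rw [h1, h2, hee]
      · exact absurd hc (hlt e' he' h2).ne'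
      · exact absurd hc (hlt e he h1).ne
      · exact hyf e (Finset.mem_filter.2 ⟨he, h1⟩) e' (Finset.mem_filter.2 ⟨he', h2⟩) hee hc
    · intro e he e' he' hee hc
      dsimp only at hc
      split_ifs at hc with h1 h2 h2
      · have : m (f e) = m (f e') := by rw [← hεg (f e), ← hεg (f e'), ← h1, ← h2, hee]
        rw [h1, h2, hm this]
      · exact absurd hc (hlt e' he' h2).ne'
      · exact absurd hc (hlt e he h1).ne
      · exact hyg e (Finset.mem_filter.2 ⟨he, h1⟩) e' (Finset.mem_filter.2 ⟨he', h2⟩) hee hc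

theorem card_filter_univ_sum {α β : Type*} [Fintype α] [Fintype β] {p : α ⊕ β → Prop}
    {q : α → Prop} {r : β → Prop} [DecidablePred p] [DecidablePred q] [DecidablePred r]
    (hq : ∀ a, p (Sum.inl a) ↔ q a) (hr : ∀ b, p (Sum.inr b) ↔ r b) :
    (Finset.univ.filter p).card = (Finset.univ.filter q).card + (Finset.univ.filter r).card := by
  simp only [Finset.card_filter, Fintype.sum_sum_type, hq, hr]

theorem card_filter_sigma_fst {A : Type*} [Fintype A] [DecidableEq A] (d : A → ℕ) (a : A) :
    (Finset.univ.filter fun x : (Σ a : A, Fin (d a)) => x.1 = a).card = d a := by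
  rw [Finset.card_filter, Fintype.sum_sigma]
  trans ∑ x, if x = a then d x else 0
  · refine Finset.sum_congr rfl fun x _ => ?_
    by_cases hx : x = a <;> simp [hx]
  · simp

/-- **König's edge colouring theorem**: a bipartite multigraph (edges `E`, endpoint maps `f` and
`g`) of maximum degree at most `h` has a proper edge colouring with `h` colours. -/
theorem exists_proper_coloring {E A B C : Type*} [Fintype E]
    [Fintype A] [DecidableEq A] [Fintype B] [DecidableEq B] [Fintype C] (f : E → A) (g : E → B)
    (hf : ∀ a, (Finset.univ.filter fun e => f e = a).card ≤ Fintype.card C)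
    (hg : ∀ b, (Finset.univ.filter fun e => g e = b).card ≤ Fintype.card C) :
    ∃ y : E → C, (∀ e e', f e = f e' → y e = y e' → e = e') ∧
      (∀ e e', g e = g e' → y e = y e' → e = e') := by
  classical
  set h := Fintype.card C with hC
  let dA : A → ℕ := fun a => (Finset.univ.filter fun e => f e = a).card
  let dB : B → ℕ := fun b => (Finset.univ.filter fun e => g e = b).card
  -- Regularization: take the graph and its mirror image with sides exchanged, and join the two
  -- copies of each vertex by as many dummy edges as its degree falls short of h.
  let F : (E ⊕ E) ⊕ ((Σ a : A, Fin (h - dA a)) ⊕ (Σ b : B, Fin (h - dB b))) → A ⊕ B :=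
    Sum.elim (Sum.map f g) (Sum.map Sigma.fst Sigma.fst)
  let G : (E ⊕ E) ⊕ ((Σ a : A, Fin (h - dA a)) ⊕ (Σ b : B, Fin (h - dB b))) → A ⊕ B :=
    Sum.elim (Sum.elim (fun e => Sum.inr (g e)) (fun e => Sum.inl (f e)))
      (Sum.map Sigma.fst Sigma.fst)
  let R : (Σ a : A, Fin (h - dA a)) ⊕ (Σ b : B, Fin (h - dB b)) → A ⊕ B :=
    Sum.map Sigma.fst Sigma.fst
  have hF : ∀ v, (Finset.univ.filter fun e => F e = v).card = h := by
    let Q : E ⊕ E → A ⊕ B := Sum.map f g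
    rintro (v | v)
    · rw [card_filter_univ_sum (q := fun e => Q e = Sum.inl v) (r := fun e => R e = Sum.inl v)
          (fun _ => Iff.rfl) (fun _ => Iff.rfl),
        card_filter_univ_sum (p := fun e => Q e = Sum.inl v) (q := fun e => f e = v) (r := fun e => False)
          (fun _ => by simp [Q]) (fun _ => by simp [Q]),
        card_filter_univ_sum (p := fun e => R e = Sum.inl v) (q := fun e => e.1 = v) (r := fun e => False)
          (fun _ => by simp [R]) (fun _ => by simp [R]), card_filter_sigma_fst (fun a => h - dA a)]
      simpa using Nat.add_sub_cancel' (hf v)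
    · rw [card_filter_univ_sum (q := fun e => Q e = Sum.inr v) (r := fun e => R e = Sum.inr v)
          (fun _ => Iff.rfl) (fun _ => Iff.rfl),
        card_filter_univ_sum (p := fun e => Q e = Sum.inr v) (q := fun e => False) (r := fun e => g e = v)
          (fun _ => by simp [Q]) (fun _ => by simp [Q]),
        card_filter_univ_sum (p := fun e => R e = Sum.inr v) (q := fun e => False) (r := fun e => e.1 = v)
          (fun _ => by simp [R]) (fun _ => by simp [R]), card_filter_sigma_fst (fun b => h - dB b)]
      simpa using Nat.add_sub_cancel' (hg v)
  have hG : ∀ v, (Finset.univ.filter fun e => G e = v).card = h := by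
    let Q : E ⊕ E → A ⊕ B := Sum.elim (fun e => Sum.inr (g e)) (fun e => Sum.inl (f e))
    rintro (v | v)
    · rw [card_filter_univ_sum (q := fun e => Q e = Sum.inl v) (r := fun e => R e = Sum.inl v)
          (fun _ => Iff.rfl) (fun _ => Iff.rfl),
        card_filter_univ_sum (p := fun e => Q e = Sum.inl v) (q := fun e => False) (r := fun e => f e = v)
          (fun _ => by simp [Q]) (fun _ => by simp [Q]),
        card_filter_univ_sum (p := fun e => R e = Sum.inl v) (q := fun e => e.1 = v) (r := fun e => False)
          (fun _ => by simp [R]) (fun _ => by simp [R]), card_filter_sigma_fst (fun a => h - dA a)]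
      simpa using Nat.add_sub_cancel' (hf v)
    · rw [card_filter_univ_sum (q := fun e => Q e = Sum.inr v) (r := fun e => R e = Sum.inr v)
          (fun _ => Iff.rfl) (fun _ => Iff.rfl),
        card_filter_univ_sum (p := fun e => Q e = Sum.inr v) (q := fun e => g e = v) (r := fun e => False)
          (fun _ => by simp [Q]) (fun _ => by simp [Q]),
        card_filter_univ_sum (p := fun e => R e = Sum.inr v) (q := fun e => False) (r := fun e => e.1 = v)
          (fun _ => by simp [R]) (fun _ => by simp [R]), card_filter_sigma_fst (fun b => h - dB b)]
      simpa using Nat.add_sub_cancel' (hg v)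
  obtain ⟨y, hy, hyF, hyG⟩ := exists_proper_coloring_of_regular F G h Finset.univ hF hG
  let ι : E → (E ⊕ E) ⊕ ((Σ a : A, Fin (h - dA a)) ⊕ (Σ b : B, Fin (h - dB b))) :=
    fun e => Sum.inl (Sum.inl e)
  have hι : ∀ {e e'}, ι e = ι e' → e = e' := fun hee => Sum.inl_injective (Sum.inl_injective hee)
  let φ := (Fintype.equivFin C).symm
  refine ⟨fun e => φ ⟨y (ι e), hy _ (Finset.mem_univ _)⟩, fun e e' hee hc => ?_,
    fun e e' hee hc => ?_⟩
  · exact hι (hyF _ (Finset.mem_univ _) _ (Finset.mem_univ _) (congrArg Sum.inl hee)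
      (Fin.mk.inj_iff.1 (φ.injective hc)))
  · exact hι (hyG _ (Finset.mem_univ _) _ (Finset.mem_univ _) (congrArg Sum.inr hee)
      (Fin.mk.inj_iff.1 (φ.injective hc)))

/-! ### Equitable and uniform colourings of finite sets -/

/-- Each colour occurs `K` or `K + 1` times on `s`, for some `K`. -/
def IsEquitableOn {E C : Type*} [DecidableEq C] (s : Finset E) (y : E → C) : Prop :=
  ∃ K, ∀ c, K ≤ (s.filter fun e => y e = c).card ∧ (s.filter fun e => y e = c).card ≤ K + 1

/-- All colours occur equally often on `s`. -/
def IsUniformOn {E C : Type*} [DecidableEq C] (s : Finset E) (y : E → C) : Prop :=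
  ∃ K, ∀ c, (s.filter fun e => y e = c).card = K

theorem card_eq_sum_card_color {E C : Type*} [Fintype C] [DecidableEq C] (s : Finset E)
    (y : E → C) : s.card = ∑ c, (s.filter fun e => y e = c).card :=
  Finset.card_eq_sum_card_fiberwise fun _ _ => Finset.mem_univ _

/-- On an equitably coloured set of size `m`, each colour occurs `⌊m / h⌋` or `⌈m / h⌉` times. -/
theorem IsEquitableOn.bounds {E C : Type*} [Fintype C] [DecidableEq C] {s : Finset E} {y : E → C}
    (hy : IsEquitableOn s y) (c : C) :
    s.card / Fintype.card C ≤ (s.filter fun e => y e = c).card ∧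
      (s.filter fun e => y e = c).card * Fintype.card C < s.card + Fintype.card C := by
  obtain ⟨K, hK⟩ := hy
  have hpos : 0 < Fintype.card C := Fintype.card_pos_iff.2 ⟨c⟩
  have hsum := card_eq_sum_card_color s y
  have hconst : ∀ k : ℕ, ∑ _c : C, k = Fintype.card C * k := fun k => by simp
  rcases Nat.lt_or_ge K (s.filter fun e => y e = c).card with hlt | hge
  · have h1 : Fintype.card C * K < s.card := by
      rw [hsum, ← hconst]
      exact Finset.sum_lt_sum (fun c _ => (hK c).1) ⟨c, Finset.mem_univ _, hlt⟩
    have h2 : s.card ≤ Fintype.card C * (K + 1) := by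
      rw [hsum, ← hconst]
      exact Finset.sum_le_sum fun c _ => (hK c).2
    have h3 : (s.filter fun e => y e = c).card = K + 1 := le_antisymm (hK c).2 hlt
    rw [h3]
    exact ⟨Nat.div_le_of_le_mul h2, by nlinarith⟩
  · have h1 : Fintype.card C * K ≤ s.card := by
      rw [hsum, ← hconst]
      exact Finset.sum_le_sum fun c _ => (hK c).1
    have h3 : (s.filter fun e => y e = c).card = K := le_antisymm hge (hK c).1
    have h2 : s.card < Fintype.card C * (K + 1) := by
      rw [hsum, ← hconst]
      exact Finset.sum_lt_sum (fun c _ => (hK c).2) ⟨c, Finset.mem_univ _, by omega⟩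
    rw [h3]
    exact ⟨Nat.le_of_lt_succ (Nat.div_lt_of_lt_mul h2), by nlinarith⟩

theorem IsUniformOn.mul_eq_card {E C : Type*} [Fintype C] [DecidableEq C] {s : Finset E}
    {y : E → C} (hy : IsUniformOn s y) (c : C) :
    Fintype.card C * (s.filter fun e => y e = c).card = s.card := by
  obtain ⟨K, hK⟩ := hy
  rw [card_eq_sum_card_color s y]
  simp [hK]

/-- When h divides the size, floor and ceiling of the average coincide. This is why the construction
uses vertices of size divisible by h. -/
theorem IsEquitableOn.isUniformOn {E C : Type*} [Fintype C] [DecidableEq C] {s : Finset E}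
    {y : E → C} (hy : IsEquitableOn s y) (hs : Fintype.card C ∣ s.card) : IsUniformOn s y := by
  refine ⟨s.card / Fintype.card C, fun c => le_antisymm ?_ (hy.bounds c).1⟩
  have hpos : 0 < Fintype.card C := Fintype.card_pos_iff.2 ⟨c⟩
  obtain ⟨k, hk⟩ := hs
  have h1 := (hy.bounds c).2
  rw [hk] at h1 ⊢
  rw [Nat.mul_div_cancel_left _ hpos]
  exact Nat.le_of_lt_succ (Nat.lt_of_mul_lt_mul_right (a := Fintype.card C) (by nlinarith))

theorem isUniformOn_empty {E C : Type*} [DecidableEq C] (y : E → C) :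
    IsUniformOn (∅ : Finset E) y := ⟨0, fun _ => by simp⟩

theorem filter_card_eq_sum_fiberwise {E C J : Type*} [DecidableEq C] [Fintype J] [DecidableEq J]
    (s : Finset E) (y : E → C) (P : E → J) (c : C) :
    (s.filter fun e => y e = c).card =
      ∑ j, ((s.filter fun e => P e = j).filter fun e => y e = c).card := by
  rw [Finset.card_eq_sum_card_fiberwise (f := P) (t := Finset.univ) fun _ _ => Finset.mem_univ _]
  exact Finset.sum_congr rfl fun j _ => by rw [Finset.filter_comm]

/-- If a set is cut into parts, all but one of which are uniformly coloured and the last of which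
is equitably coloured, then it is equitably coloured. -/
theorem IsEquitableOn.of_fiberwise {E C J : Type*} [DecidableEq C] [Fintype J] [DecidableEq J]
    {s : Finset E} {y : E → C} (P : E → J) (j₀ : J)
    (h₀ : IsEquitableOn (s.filter fun e => P e = j₀) y)
    (hP : ∀ j, j ≠ j₀ → IsUniformOn (s.filter fun e => P e = j) y) : IsEquitableOn s y := by
  obtain ⟨K, hK⟩ := h₀
  have hP' : ∀ j, ∃ k, j ≠ j₀ → ∀ c,
      ((s.filter fun e => P e = j).filter fun e => y e = c).card = k := fun j => by
    by_cases hj : j = j₀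
    · exact ⟨0, fun h => (h hj).elim⟩
    · obtain ⟨k, hk⟩ := hP j hj
      exact ⟨k, fun _ => hk⟩
  choose k hk using hP'
  refine ⟨K + ∑ j ∈ Finset.univ.erase j₀, k j, fun c => ?_⟩
  rw [filter_card_eq_sum_fiberwise s y P c, ← Finset.add_sum_erase _ _ (Finset.mem_univ j₀),
    Finset.sum_congr rfl fun j hj => hk j (Finset.ne_of_mem_erase hj) c]
  have := hK c
  constructor <;> linarith

/-! ### Equitable edge colourings -/

/-- The fibres of any map can be cut into blocks of at most `h` elements such that every colouring
with `h` colours that is injective on blocks is equitable on fibres. -/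
theorem exists_block_refinement {E A : Type*} [Fintype E] [DecidableEq A] (f : E → A)
    (C : Type*) [Fintype C] [Nonempty C] [DecidableEq C] :
    ∃ β : E → Fin (Fintype.card E + 1),
      (∀ a j, (Finset.univ.filter fun e => f e = a ∧ β e = j).card ≤ Fintype.card C) ∧
      ∀ y : E → C, (∀ e e', f e = f e' → β e = β e' → y e = y e' → e = e') →
        ∀ a, IsEquitableOn (Finset.univ.filter fun e => f e = a) y := by
  classical
  set h := Fintype.card C with hC
  have hpos : 0 < h := Fintype.card_pos
  let m : A → ℕ := fun a => Fintype.card {e // f e = a}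
  let φ : ∀ a, {e // f e = a} ≃ Fin (m a) := fun a => Fintype.equivFin _
  -- Each fibre is numbered from 0; the quotient of the number by h is the block, so only the last
  -- block can be incomplete.
  let idx : E → ℕ := fun e => (φ (f e) ⟨e, rfl⟩ : ℕ)
  have hidx_eq : ∀ a e (he : f e = a), idx e = (φ a ⟨e, he⟩ : ℕ) := by
    rintro a e rfl
    rfl
  have hidx_lt : ∀ e, idx e < m (f e) := fun e => (φ (f e) ⟨e, rfl⟩).2
  have hidx_inj : ∀ e e', f e = f e' → idx e = idx e' → e = e' := by
    intro e e' hee hi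
    rw [hidx_eq _ e hee, hidx_eq _ e' rfl] at hi
    exact congrArg Subtype.val ((φ _).injective (Fin.ext hi))
  have hidx_surj : ∀ a k, k < m a → ∃ e, f e = a ∧ idx e = k := by
    intro a k hk
    refine ⟨(φ a).symm ⟨k, hk⟩, ((φ a).symm ⟨k, hk⟩).2, ?_⟩
    rw [hidx_eq a _ ((φ a).symm ⟨k, hk⟩).2]
    simp
  have hm : ∀ a, m a ≤ Fintype.card E := fun a => Fintype.card_subtype_le _
  refine ⟨fun e => ⟨idx e / h, Nat.lt_succ_of_le ((Nat.div_le_self _ _).trans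
    ((hidx_lt e).le.trans (hm _)))⟩, ?_, ?_⟩
  · intro a j
    have : (Finset.univ.filter fun e => f e = a ∧ (⟨idx e / h, Nat.lt_succ_of_le
        ((Nat.div_le_self _ _).trans ((hidx_lt e).le.trans (hm _)))⟩ :
          Fin (Fintype.card E + 1)) = j).card ≤ (Finset.range h).card := by
      refine Finset.card_le_card_of_injOn (fun e => idx e % h)
        (fun e _ => Finset.mem_coe.2 (Finset.mem_range.2 (Nat.mod_lt _ hpos))) ?_
      intro e he e' he' hee
      simp only [Finset.coe_filter, Finset.mem_univ, true_and, Set.mem_ofPred_eq] at he he'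
      have h1 : idx e / h = idx e' / h := congrArg Fin.val (he.2.trans he'.2.symm)
      refine hidx_inj e e' (he.1.trans he'.1.symm) ?_
      rw [← Nat.div_add_mod (idx e) h, ← Nat.div_add_mod (idx e') h, h1]
      exact congrArg _ hee
    rwa [Finset.card_range] at this
  · intro y hy a
    have hy' : ∀ e e', f e = a → f e' = a → idx e / h = idx e' / h → y e = y e' → e = e' :=
      fun e e' h1 h2 h3 => hy e e' (h1.trans h2.symm) (Fin.ext h3)
    refine ⟨m a / h, fun c => ⟨?_, ?_⟩⟩
    -- A full block has h elements, so injectivity makes it use every colour; this gives the lower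
    -- bound.
    · have hex : ∀ j < m a / h, ∃ e, f e = a ∧ idx e / h = j ∧ y e = c := by
        intro j hj
        have hlt : ∀ r : Fin h, j * h + r < m a := fun r => by
          have h1 : (j + 1) * h ≤ m a :=
            (Nat.mul_le_mul_right h hj).trans (Nat.div_mul_le_self _ _)
          have := r.2
          rw [Nat.succ_mul] at h1
          omega
        choose ε hεf hεi using fun r : Fin h => hidx_surj a _ (hlt r)
        have hdiv : ∀ r, idx (ε r) / h = j := fun r => by
          rw [hεi, Nat.mul_comm, Nat.mul_add_div hpos, Nat.div_eq_of_lt r.2, add_zero]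
        have hinj : Function.Injective fun r => y (ε r) := by
          intro r r' hrr
          have h1 := hy' _ _ (hεf r) (hεf r') ((hdiv r).trans (hdiv r').symm) hrr
          have h2 := hεi r
          rw [h1, hεi r'] at h2
          exact Fin.ext (by omega)
        obtain ⟨r, hr⟩ :=
          ((Fintype.bijective_iff_injective_and_card _).2 ⟨hinj, by simp [hC]⟩).2 c
        exact ⟨ε r, hεf r, hdiv r, hr⟩
      rw [← Finset.card_range (m a / h)]
      refine Finset.card_le_card_of_surjOn (fun e => idx e / h) fun j hj => ?_
      obtain ⟨e, he, hej, hec⟩ := hex j (Finset.mem_range.1 hj)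
      exact ⟨e, by simp [he, hec], hej⟩
    · rw [← Finset.card_range (m a / h + 1)]
      refine Finset.card_le_card_of_injOn (fun e => idx e / h) ?_ ?_
      · intro e he
        simp only [Finset.coe_filter, Finset.mem_filter, Finset.mem_univ, true_and,
          Set.mem_ofPred_eq] at he
        have := hidx_lt e
        rw [he.1] at this
        exact Finset.mem_coe.2 (Finset.mem_range.2 (Nat.lt_succ_of_le (Nat.div_le_div_right this.le)))
      · intro e he e' he' hee
        simp only [Finset.coe_filter, Finset.mem_filter, Finset.mem_univ, true_and,
          Set.mem_ofPred_eq] at he he'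
        exact hy' e e' he.1 he'.1 hee (he.2.trans he'.2.symm)

/-- A proper edge colouring can be chosen with colour classes of almost equal sizes. -/
theorem exists_equitable_proper_coloring {E A B C : Type*} [Fintype E]
    [Fintype A] [DecidableEq A] [Fintype B] [DecidableEq B] [Fintype C] [Nonempty C]
    [DecidableEq C] (f : E → A) (g : E → B)
    (hf : ∀ a, (Finset.univ.filter fun e => f e = a).card ≤ Fintype.card C)
    (hg : ∀ b, (Finset.univ.filter fun e => g e = b).card ≤ Fintype.card C) :
    ∃ y : E → C, (∀ e e', f e = f e' → y e = y e' → e = e') ∧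
      (∀ e e', g e = g e' → y e = y e' → e = e') ∧ IsEquitableOn Finset.univ y := by
  classical
  set h := Fintype.card C with hC
  have hpos : 0 < h := Fintype.card_pos
  let d : A → ℕ := fun a => (Finset.univ.filter fun e => f e = a).card
  -- Dummy edges raise every degree on the A side to exactly h, so each colour then meets each a
  -- once and has |A| edges in all. On the other side the dummies are grouped in blocks, hence
  -- coloured equitably, and so are the real edges as their complement.
  let D := Σ a : A, Fin (h - d a)
  obtain ⟨β, hβ, hβy⟩ := exists_block_refinement (fun _ : D => ()) C
  let F : E ⊕ D → A := Sum.elim f Sigma.fst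
  let G : E ⊕ D → B ⊕ Fin (Fintype.card D + 1) := Sum.map g β
  have hF : ∀ a, (Finset.univ.filter fun e => F e = a).card = h := by
    intro a
    rw [card_filter_univ_sum (q := fun e => f e = a) (r := fun e : D => e.1 = a)
      (fun _ => Iff.rfl) (fun _ => Iff.rfl), card_filter_sigma_fst (fun a => h - d a)]
    exact Nat.add_sub_cancel' (hf a)
  have hG : ∀ v, (Finset.univ.filter fun e => G e = v).card ≤ h := by
    rintro (b | j)
    · rw [card_filter_univ_sum (q := fun e => g e = b) (r := fun _ => False)
        (fun _ => by simp [G]) (fun _ => by simp [G])]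
      simpa using hg b
    · rw [card_filter_univ_sum (q := fun _ => False) (r := fun e => β e = j)
        (fun _ => by simp [G]) (fun _ => by simp [G])]
      simpa using hβ () j
  obtain ⟨y, hyF, hyG⟩ := exists_proper_coloring (C := C) F G (fun a => (hF a).le) hG
  refine ⟨fun e => y (Sum.inl e), fun e e' hee hc => Sum.inl_injective (hyF _ _ hee hc),
    fun e e' hee hc => Sum.inl_injective (hyG _ _ (congrArg Sum.inl hee) hc), ?_⟩
  obtain ⟨K, hK⟩ := hβy (fun x => y (Sum.inr x))
    (fun e e' _ hee hc => Sum.inr_injective (hyG _ _ (congrArg Sum.inr hee) hc)) ()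
  simp only [Finset.filter_true] at hK
  have htot : ∀ c, (Finset.univ.filter fun e => y e = c).card = Fintype.card A := by
    intro c
    rw [← Finset.card_univ, ← Finset.card_image_of_injOn (f := F)
      (s := Finset.univ.filter fun e => y e = c)]
    · congr 1
      refine Finset.eq_univ_iff_forall.2 fun a => ?_
      have hinj : Set.InjOn y (Finset.univ.filter fun e => F e = a : Finset (E ⊕ D)) := by
        intro e he e' he' hee
        simp only [Finset.coe_filter, Finset.mem_univ, true_and, Set.mem_ofPred_eq] at he he'
        exact hyF e e' (he.trans he'.symm) hee
      have himg := (Finset.card_eq_iff_eq_univ _).1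
        ((Finset.card_image_of_injOn hinj).trans (hF a))
      obtain ⟨e, he, hec⟩ := Finset.mem_image.1 (himg ▸ Finset.mem_univ c)
      exact Finset.mem_image.2 ⟨e, Finset.mem_filter.2 ⟨Finset.mem_univ _, hec⟩,
        (Finset.mem_filter.1 he).2⟩
    · intro e he e' he' hee
      simp only [Finset.coe_filter, Finset.mem_univ, true_and, Set.mem_ofPred_eq] at he he'
      exact hyF e e' hee (he.trans he'.symm)
  refine ⟨Fintype.card A - (K + 1), fun c => ?_⟩
  have h1 := hK c
  have h2 := htot c
  rw [card_filter_univ_sum (q := fun e => y (Sum.inl e) = c) (r := fun e => y (Sum.inr e) = c)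
    (fun _ => Iff.rfl) (fun _ => Iff.rfl)] at h2
  dsimp only
  omega

/-- **de Werra's theorem**: a bipartite multigraph has, for every number of colours, an edge
colouring that is equitable at every vertex and on the whole edge set. -/
theorem exists_equitable_coloring {E A B C : Type*} [Fintype E]
    [Fintype A] [DecidableEq A] [Fintype B] [DecidableEq B] [Fintype C] [Nonempty C]
    [DecidableEq C] (f : E → A) (g : E → B) :
    ∃ y : E → C, (∀ a, IsEquitableOn (Finset.univ.filter fun e => f e = a) y) ∧
      (∀ b, IsEquitableOn (Finset.univ.filter fun e => g e = b) y) ∧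
      IsEquitableOn Finset.univ y := by
  -- Splitting each vertex into blocks bounds the degrees by h, so a proper colouring of the split
  -- graph exists.
  obtain ⟨β, hβ, hβy⟩ := exists_block_refinement f C
  obtain ⟨γ, hγ, hγy⟩ := exists_block_refinement g C
  obtain ⟨y, hyf, hyg, hy⟩ := exists_equitable_proper_coloring (C := C)
    (fun e => (f e, β e)) (fun e => (g e, γ e))
    (fun v => by simpa only [Prod.ext_iff] using hβ v.1 v.2)
    (fun v => by simpa only [Prod.ext_iff] using hγ v.1 v.2)
  exact ⟨y, hβy y fun e e' h1 h2 => hyf e e' (Prod.ext h1 h2),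
    hγy y fun e e' h1 h2 => hyg e e' (Prod.ext h1 h2), hy⟩

/-! ### The colouring for three vectors -/

/-- If every cell of `(x₁, x₂)` has at least `h` elements, and at most one more than a multiple of
`h`, then a colouring with `h` colours exists that is equitable on the fibres of `x₁`, `x₂`, `x₃`
and on the whole set and uses every colour in every cell of `(x₁, x₂)`. -/
theorem exists_equitable_coloring_of_three {E A B Γ C : Type*} [Fintype E] [DecidableEq E]
    [Fintype A] [DecidableEq A] [Fintype B] [DecidableEq B] [Nonempty B]
    [Fintype Γ] [DecidableEq Γ] [Nonempty Γ] [Fintype C] [Nonempty C] [DecidableEq C]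
    (x₁ : E → A) (x₂ : E → B) (x₃ : E → Γ)
    (hind : ∀ a b c, ∃ j, x₁ j = a ∧ x₂ j = b ∧ x₃ j = c)
    (h₁₂ : ∀ a b, Fintype.card C ≤ (Finset.univ.filter fun e => x₁ e = a ∧ x₂ e = b).card)
    (hmod : ∀ a b,
      (Finset.univ.filter fun e => x₁ e = a ∧ x₂ e = b).card % Fintype.card C ≤ 1)
    (h₁₃ : ∀ a c, Fintype.card C ≤ (Finset.univ.filter fun e => x₁ e = a ∧ x₃ e = c).card) :
    ∃ y : E → C, IsEquitableOn Finset.univ y ∧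
      (∀ a b c, ∃ j, x₁ j = a ∧ x₂ j = b ∧ y j = c) ∧
      (∀ a, IsEquitableOn (Finset.univ.filter fun e => x₁ e = a) y) ∧
      (∀ b, IsEquitableOn (Finset.univ.filter fun e => x₂ e = b) y) ∧
      (∀ c, IsEquitableOn (Finset.univ.filter fun e => x₃ e = c) y) := by
  classical
  set h := Fintype.card C with hC
  have hpos : 0 < h := Fintype.card_pos
  obtain ⟨c₀, c₁, hc⟩ : ∃ c₀ c₁ : Γ, c₀ ≠ c₁ ∨ Subsingleton Γ := by
    by_cases hΓ : Subsingleton Γ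
    · obtain ⟨c⟩ := ‹Nonempty Γ›
      exact ⟨c, c, Or.inr hΓ⟩
    · rw [not_subsingleton_iff_nontrivial] at hΓ
      obtain ⟨c, c', hne⟩ := exists_pair_ne Γ
      exact ⟨c, c', Or.inl hne⟩
  let cell : A → B → Finset E := fun a b => Finset.univ.filter fun e => x₁ e = a ∧ x₂ e = b
  let I : A → B → Prop := fun a b => (cell a b).card % h = 1
  let Bf : A → Finset B := fun a => Finset.univ.filter fun b => I a b
  have hR : ∀ a, ∃ R ⊆ Bf a, R.card = (Bf a).card % h := fun a =>
    Finset.exists_subset_card_eq (Nat.mod_le _ _)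
  choose R hRB hRcard using hR
  choose ℓ hℓ₁ hℓ₂ hℓ₃ using fun a b => hind a b (if b ∈ R a then c₁ else c₀)
  let Lf : E → Prop := fun e => I (x₁ e) (x₂ e) ∧ e = ℓ (x₁ e) (x₂ e)
  have hLfℓ : ∀ a b, I a b → Lf (ℓ a b) := fun a b hab => by
    simpa only [Lf, hℓ₁, hℓ₂, and_true] using hab
  have hℓinj : ∀ a, Function.Injective (ℓ a) := fun a b b' hbb => by
    rw [← hℓ₂ a b, ← hℓ₂ a b', hbb]
  have hℓcell : ∀ a b, ℓ a b ∈ cell a b := fun a b =>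
    Finset.mem_filter.2 ⟨Finset.mem_univ _, hℓ₁ a b, hℓ₂ a b⟩
  -- the `h`-sets that contain the leftovers indexed by `R`
  have hT : ∀ a, ∃ T : Finset E, (R a).image (ℓ a) ⊆ T ∧
      T ⊆ (Finset.univ.filter fun e => x₁ e = a ∧ x₃ e = c₁ ∧ ¬ (Lf e ∧ x₂ e ∉ R a)) ∧
      T.card = h := by
    intro a
    refine Finset.exists_subsuperset_card_eq ?_ ?_ ?_
    · intro e he
      obtain ⟨b, hb, rfl⟩ := Finset.mem_image.1 he
      have h3 := hℓ₃ a b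
      rw [if_pos hb] at h3
      rw [Finset.mem_filter]
      exact ⟨Finset.mem_univ _, hℓ₁ a b, h3, fun h4 => h4.2 ((hℓ₂ a b).symm ▸ hb)⟩
    · refine Finset.card_image_le.trans ?_
      rw [hRcard]
      exact (Nat.mod_lt _ hpos).le
    -- If c₀ ≠ c₁, leftovers off R avoid the fibre of c₁, so all of (a, c₁) is available. If Γ is a
    -- single point, one cell minus its possible leftover still has h elements.
    · rcases hc with hne | hsub
      · refine (h₁₃ a c₁).trans (Finset.card_le_card fun e he => ?_)
        rw [Finset.mem_filter] at he ⊢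
        refine ⟨he.1, he.2.1, he.2.2, ?_⟩
        rintro ⟨⟨_, h4⟩, h5⟩
        have h6 := hℓ₃ (x₁ e) (x₂ e)
        rw [← h4, he.2.1, if_neg h5, he.2.2] at h6
        exact hne h6.symm
      · obtain ⟨b⟩ := ‹Nonempty B›
        have hsubset : ∀ s : Finset E, s ⊆ cell a b → (I a b → ℓ a b ∉ s) →
            s ⊆ (Finset.univ.filter fun e => x₁ e = a ∧ x₃ e = c₁ ∧ ¬ (Lf e ∧ x₂ e ∉ R a)) := by
          intro s hs hns e he
          obtain ⟨_, h1, h2⟩ := Finset.mem_filter.1 (hs he)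
          rw [Finset.mem_filter]
          refine ⟨Finset.mem_univ _, h1, Subsingleton.elim _ _, ?_⟩
          rintro ⟨⟨h3, h4⟩, -⟩
          rw [h1, h2] at h3 h4
          exact hns h3 (h4 ▸ he)
        by_cases hab : I a b
        · refine le_trans ?_ (Finset.card_le_card (hsubset ((cell a b).erase (ℓ a b))
            (Finset.erase_subset _ _) fun _ => Finset.notMem_erase _ _))
          rw [Finset.card_erase_of_mem (hℓcell a b)]
          refine Nat.le_sub_one_of_lt (lt_of_le_of_ne (h₁₂ a b) fun h5 => ?_)
          have h6 : (cell a b).card % h = 1 := hab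
          have h7 : (cell a b).card = h := h5.symm
          rw [h7, Nat.mod_self] at h6
          exact zero_ne_one h6
        · exact (h₁₂ a b).trans (Finset.card_le_card (hsubset (cell a b) subset_rfl
            fun h5 => (hab h5).elim))
  choose T hRT hTsub hTcard using hT
  have hT₁ : ∀ {a e}, e ∈ T a → x₁ e = a := fun he => (Finset.mem_filter.1 (hTsub _ he)).2.1
  have hT₃ : ∀ {a e}, e ∈ T a → x₃ e = c₁ := fun he => (Finset.mem_filter.1 (hTsub _ he)).2.2.1
  have hTL : ∀ {a e}, e ∈ T a → ¬ (Lf e ∧ x₂ e ∉ R a) :=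
    fun he => (Finset.mem_filter.1 (hTsub _ he)).2.2.2
  let F : E → (A × B) ⊕ B := fun e => if Lf e then Sum.inr (x₂ e) else Sum.inl (x₁ e, x₂ e)
  let G : E → (A ⊕ A) ⊕ Γ := fun e =>
    if e ∈ T (x₁ e) then Sum.inl (Sum.inl (x₁ e))
    else if Lf e ∧ x₂ e ∉ R (x₁ e) then Sum.inl (Sum.inr (x₁ e)) else Sum.inr (x₃ e)
  have hFinl : ∀ e a b, F e = Sum.inl (a, b) ↔ ¬ Lf e ∧ x₁ e = a ∧ x₂ e = b := by
    intro e a b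
    by_cases h1 : Lf e <;> simp [F, h1]
  have hFinr : ∀ e b, F e = Sum.inr b ↔ Lf e ∧ x₂ e = b := by
    intro e b
    by_cases h1 : Lf e <;> simp [F, h1]
  have hGT : ∀ e a, G e = Sum.inl (Sum.inl a) ↔ e ∈ T a := by
    intro e a
    by_cases h1 : e ∈ T (x₁ e)
    · simp only [G, h1, if_true, Sum.inl.injEq]
      exact ⟨fun h2 => h2 ▸ h1, fun h2 => hT₁ h2⟩
    · have h3 : e ∉ T a := fun h2 => h1 (by rwa [hT₁ h2])
      by_cases h2 : Lf e ∧ x₂ e ∉ R (x₁ e) <;> simp [G, h1, h2, h3]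
  have hGL : ∀ e a, G e = Sum.inl (Sum.inr a) ↔ (Lf e ∧ x₂ e ∉ R a) ∧ x₁ e = a := by
    intro e a
    by_cases h1 : e ∈ T (x₁ e)
    · simp only [G, h1, if_true, Sum.inl.injEq, reduceCtorEq, false_iff]
      rintro ⟨h2, rfl⟩
      exact hTL h1 h2
    · by_cases h2 : Lf e ∧ x₂ e ∉ R (x₁ e)
      · simp only [G, if_neg h1, if_pos h2, Sum.inl.injEq, Sum.inr.injEq]
        exact ⟨fun h3 => ⟨h3 ▸ h2, h3⟩, fun h3 => h3.2⟩
      · simp only [G, if_neg h1, if_neg h2, reduceCtorEq, false_iff]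
        rintro ⟨h3, rfl⟩
        exact h2 h3
  have hGr : ∀ e c, G e = Sum.inr c → x₃ e = c := by
    intro e c
    by_cases h1 : e ∈ T (x₁ e)
    · simp [G, h1]
    · by_cases h2 : Lf e ∧ x₂ e ∉ R (x₁ e) <;> simp [G, h1, h2]
  obtain ⟨y, hyF, hyG, hy⟩ := exists_equitable_coloring (C := C) F G
  -- cells without their leftovers
  have hcellcard : ∀ a b, h ∣ (Finset.univ.filter fun e => F e = Sum.inl (a, b)).card ∧
      0 < (Finset.univ.filter fun e => F e = Sum.inl (a, b)).card := by
    intro a b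
    have hm := hmod a b
    have hle := h₁₂ a b
    change (cell a b).card % h ≤ 1 at hm
    change h ≤ (cell a b).card at hle
    by_cases hab : I a b
    · have h1 : (Finset.univ.filter fun e => F e = Sum.inl (a, b)) = (cell a b).erase (ℓ a b) := by
        ext e
        simp only [Finset.mem_filter, Finset.mem_univ, true_and, hFinl, Finset.mem_erase, cell]
        constructor
        · rintro ⟨h2, rfl, rfl⟩
          exact ⟨fun h3 => h2 ⟨hab, h3⟩, rfl, rfl⟩
        · rintro ⟨h2, rfl, rfl⟩
          exact ⟨fun h3 => h2 h3.2, rfl, rfl⟩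
      rw [h1, Finset.card_erase_of_mem (hℓcell a b)]
      have hab' : (cell a b).card % h = 1 := hab
      refine ⟨(Nat.modEq_iff_dvd' (hpos.trans_le hle)).1 ?_, ?_⟩
      · have h2 : 1 % h = 1 := by
          rw [← hab', Nat.mod_mod]
        exact h2.trans hab'.symm
      · rcases Nat.lt_or_ge 1 (cell a b).card with h2 | h2
        · omega
        · have h3 : h = 1 := by omega
          rw [h3, Nat.mod_one] at hab'
          omega
    · have h1 : (Finset.univ.filter fun e => F e = Sum.inl (a, b)) = cell a b := by
        ext e
        simp only [Finset.mem_filter, Finset.mem_univ, true_and, hFinl, cell]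
        refine ⟨fun h2 => h2.2, ?_⟩
        rintro ⟨rfl, rfl⟩
        exact ⟨fun h3 => hab h3.1, rfl, rfl⟩
      rw [h1]
      have hab' : (cell a b).card % h ≠ 1 := hab
      exact ⟨Nat.dvd_of_mod_eq_zero (by omega), by omega⟩
  have huF : ∀ a b, IsUniformOn (Finset.univ.filter fun e => F e = Sum.inl (a, b)) y :=
    fun a b => (hyF _).isUniformOn (hcellcard a b).1
  have huT : ∀ a, IsUniformOn (Finset.univ.filter fun e => G e = Sum.inl (Sum.inl a)) y := by
    intro a
    refine (hyG _).isUniformOn (Dvd.intro 1 ?_)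
    rw [mul_one, ← hC, ← hTcard a]
    congr 1
    ext e
    simp [hGT]
  have huL : ∀ a, IsUniformOn (Finset.univ.filter fun e => G e = Sum.inl (Sum.inr a)) y := by
    intro a
    refine (hyG _).isUniformOn ?_
    have h1 : (Finset.univ.filter fun e => G e = Sum.inl (Sum.inr a)) =
        (Bf a \ R a).image (ℓ a) := by
      ext e
      simp only [Finset.mem_filter, Finset.mem_univ, true_and, hGL, Finset.mem_image,
        Finset.mem_sdiff, Bf]
      constructor
      · rintro ⟨⟨⟨h2, h3⟩, h4⟩, rfl⟩
        exact ⟨x₂ e, ⟨h2, h4⟩, h3.symm⟩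
      · rintro ⟨b, ⟨h2, h3⟩, rfl⟩
        exact ⟨⟨hLfℓ a b h2, by rwa [hℓ₂]⟩, hℓ₁ a b⟩
    rw [h1, Finset.card_image_of_injective _ (hℓinj a), Finset.card_sdiff_of_subset (hRB a), hRcard]
    exact Nat.dvd_sub_mod _
  refine ⟨y, hy, ?_, ?_, ?_, ?_⟩
  · intro a b c
    have h1 := (huF a b).mul_eq_card c
    have h2 := (hcellcard a b).2
    rw [← h1] at h2
    obtain ⟨e, he⟩ := Finset.card_pos.1 (Nat.pos_of_mul_pos_left h2)
    simp only [Finset.mem_filter, Finset.mem_univ, true_and, hFinl] at he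
    exact ⟨e, he.1.2.1, he.1.2.2, he.2⟩
  · intro a
    let P : E → B ⊕ Bool := fun e => if Lf e then Sum.inr (decide (x₂ e ∈ R a)) else Sum.inl (x₂ e)
    refine IsEquitableOn.of_fiberwise P (Sum.inr true) ?_ ?_
    -- The leftovers indexed by R lie in T a, where each colour occurs exactly once, so no colour
    -- repeats among them.
    · refine ⟨0, fun c => ⟨Nat.zero_le _, ?_⟩⟩
      have h1 := (huT a).mul_eq_card c
      have h2 : (Finset.univ.filter fun e => G e = Sum.inl (Sum.inl a)).card = h := by
        rw [← hTcard a]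
        congr 1
        ext e
        simp [hGT]
      rw [h2, ← hC] at h1
      rw [zero_add, ← Nat.eq_of_mul_eq_mul_left hpos (h1.trans (mul_one h).symm)]
      refine Finset.card_le_card fun e he => ?_
      simp only [Finset.mem_filter, Finset.mem_univ, true_and] at he ⊢
      obtain ⟨⟨h3, h4⟩, h5⟩ := he
      refine ⟨(hGT e a).2 ?_, h5⟩
      by_cases h6 : Lf e
      · simp only [P, h6, if_true, Sum.inr.injEq, decide_eq_true_eq] at h4
        refine hRT a (Finset.mem_image.2 ⟨x₂ e, h4, ?_⟩)
        rw [← h3]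
        exact h6.2.symm
      · simp [P, h6] at h4
    · rintro (b | _ | _) hj
      · convert huF a b using 1
        ext e
        simp only [Finset.mem_filter, Finset.mem_univ, true_and, hFinl]
        by_cases h6 : Lf e <;> simp [P, h6]
      · convert huL a using 1
        ext e
        simp only [Finset.mem_filter, Finset.mem_univ, true_and, hGL]
        by_cases h6 : Lf e <;> simp [P, h6, and_comm]
      · exact (hj rfl).elim
  · intro b
    refine IsEquitableOn.of_fiberwise F (Sum.inr b) ?_ ?_
    · convert hyF (Sum.inr b) using 1
      ext e
      simp only [Finset.mem_filter, Finset.mem_univ, true_and, hFinr]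
      tauto
    · rintro (⟨a, b'⟩ | b') hj
      · by_cases hb : b' = b
        · subst hb
          convert huF a b' using 1
          ext e
          simp only [Finset.mem_filter, Finset.mem_univ, true_and, hFinl]
          tauto
        · convert isUniformOn_empty y using 1
          ext e
          simp only [Finset.mem_filter, Finset.mem_univ, true_and, hFinl, Finset.notMem_empty,
            iff_false]
          rintro ⟨h1, -, -, h2⟩
          exact hb (h2.symm.trans h1)
      · convert isUniformOn_empty y using 1
        ext e
        simp only [Finset.mem_filter, Finset.mem_univ, true_and, hFinr, Finset.notMem_empty,
          iff_false]
        rintro ⟨h1, -, h2⟩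
        exact hj (congrArg Sum.inr (h2.symm.trans h1))
  · intro c
    have hsplit : ∀ j d, (∀ e, G e = j → x₃ e = d) →
        IsUniformOn (Finset.univ.filter fun e => G e = j) y →
        IsUniformOn ((Finset.univ.filter fun e => x₃ e = c).filter fun e => G e = j) y := by
      intro j d hjd hj
      by_cases hd : d = c
      · subst hd
        convert hj using 1
        ext e
        simp only [Finset.mem_filter, Finset.mem_univ, true_and]
        exact ⟨fun h1 => h1.2, fun h1 => ⟨hjd e h1, h1⟩⟩
      · convert isUniformOn_empty y using 1
        ext e
        simp only [Finset.mem_filter, Finset.mem_univ, true_and, Finset.notMem_empty, iff_false]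
        rintro ⟨h1, h2⟩
        exact hd ((hjd e h2).symm.trans h1)
    refine IsEquitableOn.of_fiberwise G (Sum.inr c) ?_ ?_
    · convert hyG (Sum.inr c) using 1
      ext e
      simp only [Finset.mem_filter, Finset.mem_univ, true_and]
      exact ⟨fun h1 => h1.2, fun h1 => ⟨hGr e c h1, h1⟩⟩
    · rintro ((a | a) | c') hj
      · exact hsplit _ c₁ (fun e he => hT₃ ((hGT e a).1 he)) (huT a)
      · refine hsplit _ c₀ (fun e he => ?_) (huL a)
        obtain ⟨⟨⟨_, h2⟩, h3⟩, rfl⟩ := (hGL e a).1 he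
        have h4 := hℓ₃ (x₁ e) (x₂ e)
        rwa [← h2, if_neg h3] at h4
      · convert isUniformOn_empty y using 1
        ext e
        simp only [Finset.mem_filter, Finset.mem_univ, true_and, Finset.notMem_empty, iff_false]
        rintro ⟨h1, h2⟩
        exact hj (congrArg Sum.inr ((hGr e c' h2).symm.trans h1))

/-! ### Floors, ceilings and the final assembly -/

theorem div_le_ceilDiv {g : ℕ} (hg : 0 < g) (n : ℕ) : n / g ≤ n ⌈/⌉ g :=
  Nat.div_le_of_le_mul ((ceilDiv_le_iff_le_mul hg).1 le_rfl)

theorem ceilDiv_le_div_add_one (n g : ℕ) : n ⌈/⌉ g ≤ n / g + 1 := by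
  rcases Nat.eq_zero_or_pos g with rfl | hg
  · simp
  · rw [ceilDiv_le_iff_le_mul hg]
    exact (Nat.lt_mul_div_succ n hg).le

/-- An equitable colouring splits a set of size `⌊n / g⌋` or `⌈n / g⌉` into classes of size
`⌊n / (g * h)⌋` or `⌈n / (g * h)⌉`. -/
theorem IsEquitableOn.card_eq_or {E C : Type*} [Fintype C] [DecidableEq C] {s : Finset E}
    {y : E → C} (hy : IsEquitableOn s y) {n g : ℕ} (hg : 0 < g)
    (hs : s.card = n / g ∨ s.card = n ⌈/⌉ g) (c : C) :
    (s.filter fun e => y e = c).card = n / (g * Fintype.card C) ∨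
      (s.filter fun e => y e = c).card = n ⌈/⌉ (g * Fintype.card C) := by
  have hpos : 0 < Fintype.card C := Fintype.card_pos_iff.2 ⟨c⟩
  obtain ⟨h1, h2⟩ := hy.bounds c
  have hlow : n / g ≤ s.card := by
    rcases hs with hs | hs
    · exact hs.ge
    · rw [hs]
      exact div_le_ceilDiv hg n
  have hupp : s.card ≤ n ⌈/⌉ g := by
    rcases hs with hs | hs
    · rw [hs]
      exact div_le_ceilDiv hg n
    · exact hs.le
  have hlow' : n / (g * Fintype.card C) ≤ (s.filter fun e => y e = c).card := by
    rw [← Nat.div_div_eq_div_mul]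
    exact (Nat.div_le_div_right hlow).trans h1
  have hupp' : (s.filter fun e => y e = c).card ≤ n ⌈/⌉ (g * Fintype.card C) := by
    set k := n ⌈/⌉ (g * Fintype.card C) with hk
    have h3 : n ≤ g * Fintype.card C * k :=
      (ceilDiv_le_iff_le_mul (Nat.mul_pos hg hpos)).1 le_rfl
    have h4 : n ⌈/⌉ g ≤ Fintype.card C * k := by
      rw [ceilDiv_le_iff_le_mul hg, ← mul_assoc]
      exact h3
    refine Nat.le_of_lt_succ (Nat.lt_of_mul_lt_mul_right (a := Fintype.card C) ?_)
    nlinarith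
  have := ceilDiv_le_div_add_one n (g * Fintype.card C)
  omega

theorem IsBalanced.pairwise {n g h : ℕ} [NeZero h] (hg : 0 < g) {x : Fin n → ZMod g}
    {y : Fin n → ZMod h} (hx : IsBalanced x) (hyb : IsBalanced y)
    (hy : ∀ a, IsEquitableOn (Finset.univ.filter fun i => x i = a) y) : IsPairwiseBalanced x y := by
  refine ⟨hx, hyb, fun a b => ?_⟩
  have := (hy a).card_eq_or hg (hx a) b
  rwa [ZMod.card, Finset.filter_filter] at this

theorem mainTheorem8 (n g₁ g₂ g₃ h : ℕ)
    (hn : 0 < n) (hg₁ : 0 < g₁) (hg₂ : 0 < g₂) (hg₃ : 0 < g₃)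
    (x₁ : Fin n → ZMod g₁) (x₂ : Fin n → ZMod g₂) (x₃ : Fin n → ZMod g₃)
    (h₁₂ : IsPairwiseBalanced x₁ x₂)
    (h₁₃ : IsPairwiseBalanced x₁ x₃)
    (h₂₃ : IsPairwiseBalanced x₂ x₃)
    (hind : IsQualitativelyIndependent₃ x₁ x₂ x₃)
    (hpos : 0 < h)
    (hle : h ≤ min (n / (g₁ * g₂)) (n / (g₁ * g₃)))
    (hdvd : 3 ≤ h → n / (g₁ * g₂) ≡ 0 [MOD h]) :
    ∃ y : Fin n → ZMod h,
      IsBalanced y ∧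
      IsQualitativelyIndependent₃ x₁ x₂ y ∧
      IsPairwiseBalanced x₁ y ∧
      IsPairwiseBalanced x₂ y ∧
      IsPairwiseBalanced x₃ y := by
  have : NeZero h := ⟨hpos.ne'⟩
  have : NeZero g₁ := ⟨hg₁.ne'⟩
  have : NeZero g₂ := ⟨hg₂.ne'⟩
  have : NeZero g₃ := ⟨hg₃.ne'⟩
  have hfloor : ∀ {g k : ℕ}, 0 < g → (k = n / g ∨ k = n ⌈/⌉ g) → k = n / g ∨ k = n / g + 1 := by
    intro g k hg hk
    have h1 := ceilDiv_le_div_add_one n g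
    have h2 : n / g ≤ n ⌈/⌉ g := div_le_ceilDiv hg n
    omega
  have hcell₁₂ := fun a b => hfloor (Nat.mul_pos hg₁ hg₂) (h₁₂.2.2 a b)
  have hcell₁₃ := fun a b => hfloor (Nat.mul_pos hg₁ hg₃) (h₁₃.2.2 a b)
  obtain ⟨hle₁₂, hle₁₃⟩ := le_min_iff.1 hle
  obtain ⟨y, hy, hyi, hy₁, hy₂, hy₃⟩ :=
    exists_equitable_coloring_of_three (C := ZMod h) x₁ x₂ x₃ hind
      (fun a b => by
        rw [ZMod.card]
        have := hcell₁₂ a b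
        omega)
      (fun a b => by
        rw [ZMod.card]
        -- For h ≤ 2 every residue is at most 1, which is why divisibility is needed only from 3 on.
        rcases Nat.lt_or_ge h 3 with h3 | h3
        · exact Nat.le_of_lt_succ ((Nat.mod_lt _ hpos).trans_le (Nat.le_of_lt_succ h3))
        · have h4 : n / (g₁ * g₂) % h = 0 := hdvd h3
          rcases hcell₁₂ a b with h5 | h5
          · rw [h5, h4]
            exact Nat.zero_le _
          · rw [h5, Nat.add_mod, h4, zero_add, Nat.mod_mod]
            exact Nat.mod_le _ _)
      (fun a b => by
        rw [ZMod.card]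
        have := hcell₁₃ a b
        omega)
  have hyb : IsBalanced y := fun a => by
    have := hy.card_eq_or (n := n) one_pos (Or.inl (by simp)) a
    rwa [ZMod.card, one_mul] at this
  exact ⟨y, hyb, hyi, h₁₂.1.pairwise hg₁ hyb hy₁, h₁₂.2.1.pairwise hg₂ hyb hy₂,
    h₁₃.2.1.pairwise hg₃ hyb hy₃⟩
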